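/- Let $N\ge 1$ and $L\ge 0$ be integers, $\rho>0$, $\gamma\ge 0$, let $K_w$ be a symmetric positive semidefinite and $K_z$ a symmetric positive definite real $N\times N$ matrix. **Channel.** Consider the $L$-tap three-terminal relay channel with noiseless destination-to-source feedback, for $k=1,\dots,N$: $$u[k]=x[k]+w[k],\qquad v[k]=\sum_{1\le \ell\le \min(L,k-1)}h[\ell]\,u[k-\ell],\qquad y[k]=x[k]+v[k]+z[k],$$ where $h[1],\dots,h[L]\in\mathbb R$ are the relay taps, $w\sim\mathcal N(0,K_w)$ and $z\sim\mathcal N(0,K_z)$ are the noise vectors, the message $\theta$ is uniform on a finite set of $M\ge1$ symbols, and $\theta,w,z$ are independent. The source signal is causal with feedback, $x[k]=f_k(\theta,y[1],\dots,y[k-1])$ with $f_k$ an arbitrary measurable function, $E[x[k]^2]<\infty$, and the power constraints are $$\frac1{N+L}\sum_{k=1}^N E[x[k]^2]\le\rho,\qquad \frac1{N+L}\sum_{k=1}^N E[v[k]^2]\le\gamma\rho .$$ Let $H$ be the $N\times N$ lower triangular Toeplitz matrix with ones on the diagonal, $h[\ell]$ on the $\ell$-th subdiagonal for $1\le\ell\le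 L$, and zeros elsewhere, so that $y=Hx+(H-I)w+z$. Let $\tilde z=(I-H^{-1})w+H^{-1}z$ be the effective noise, so that $H^{-1}y=x+\tilde z$. The $(N,L)$-block feedback capacity is $$C_{\mathrm{FB},N,L}=\sup\ \frac1{2(N+L)}\log\frac{\det K_{x+\tilde z}}{\det K_{\tilde z}},$$ where $K_X$ denotes the covariance matrix of a random vector $X$, $\log$ is the natural logarithm, and the supremum is over all $M$, all taps $h$ and all source signals $x$ as above that satisfy both power constraints. **Claim.** $$C_{\mathrm{FB},N,L}=\sup_{K_s,B,H}\frac1{2(N+L)}\log\frac{\det\bigl(K_s+(I+B)K_{\tilde z}(I+B)^T\bigr)}{\det K_{\tilde z}},\qquad K_{\tilde z}=(I-H^{-1})K_w(I-H^{-1})^T+H^{-1}K_z(H^{-1})^T,$$ where the supremum is over all symmetric positive semidefinite $K_s$, all strictly lower triangular $B$ and all lower triangular $L$-banded Toeplitz $H$ with ones on the diagonal (all real $N\times N$) such that $$\mathrm{tr}\bigl(K_s+BK_{\tilde z}B^T\bigr)\le (N+L)\rho,$$ $$\mathrm{tr}\Bigl((H-I)\bigl(K_s+BK_{\tilde z}B^T+B(I-H^{-1})K_w+(B(I-H^{-1})K_w)^T+K_w\bigr)(H-I)^T\Bigr)\le\gamma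 (N+L)\rho .$$ -/

import Mathlib

open MeasureTheory ProbabilityTheory Matrix

namespace RelayChannel

/-- Outcomes: the index of the transmitted message symbol (one of `M`), the source-to-relay noise
vector `w` and the source-to-destination noise vector `z` over `N` channel uses. -/
abbrev Outcome (N M : ℕ) : Type :=
  Fin M × EuclideanSpace ℝ (Fin N) × EuclideanSpace ℝ (Fin N)

variable {N L M : ℕ}

/-- The source-to-relay noise `w[k]`. -/
def relayNoise (ω : Outcome N M) : Fin N → ℝ := fun k => ω.2.1 k

/-- The source-to-destination noise `z[k]`. -/
def destNoise (ω : Outcome N M) : Fin N → ℝ := fun k => ω.2.2 k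

/-- The joint law: the message is uniform on `M` symbols, `w ∼ N(0, Kw)`, `z ∼ N(0, Kz)`, and the
three are independent. -/
noncomputable def outcomeLaw (M : ℕ) (Kw Kz : Matrix (Fin N) (Fin N) ℝ) :
    Measure (Outcome N M) :=
  (uniformOn (Set.univ : Set (Fin M))).prod
    ((multivariateGaussian 0 Kw).prod (multivariateGaussian 0 Kz))

/-- The FIR filter with taps `h[1], …, h[L]` (`h[ℓ]` is `h ⟨ℓ - 1, _⟩`), applied to a signal that
vanishes before the first channel use: `v[k] = ∑_{ℓ = 1}^{L} h[ℓ] u[k - ℓ]`. -/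
def firFilter (h : Fin L → ℝ) (u : Fin N → ℝ) : Fin N → ℝ := fun k =>
  ∑ l : Fin L, if _hl : l.val + 1 ≤ k.val then
    h l * u ⟨k.val - (l.val + 1), lt_of_le_of_lt (Nat.sub_le _ _) k.isLt⟩ else 0

/-- The signal sent by the relay, `v[k] = ∑ h[ℓ] u[k - ℓ]` with `u[k] = x[k] + w[k]`. -/
def relayOutput (h : Fin L → ℝ) (x : Outcome N M → Fin N → ℝ) (ω : Outcome N M) : Fin N → ℝ :=
  firFilter h (x ω + relayNoise ω)

/-- The signal received by the destination, `y[k] = x[k] + v[k] + z[k]`. -/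
def received (h : Fin L → ℝ) (x : Outcome N M → Fin N → ℝ) (ω : Outcome N M) : Fin N → ℝ :=
  x ω + relayOutput h x ω + destNoise ω

/-- `x` is produced by a source encoder with noiseless unit-delay output feedback: `x[k]` is a
(measurable, not necessarily linear) function of the message and of `y[1], …, y[k - 1]`. -/
def IsFeedbackInput (h : Fin L → ℝ) (x : Outcome N M → Fin N → ℝ) : Prop :=
  ∃ f : (k : Fin N) → Fin M → (Fin k.val → ℝ) → ℝ,
    (∀ k m, Measurable (f k m)) ∧
    ∀ ω k, x ω k = f k ω.1 (fun i => received h x ω ⟨i.val, i.isLt.trans k.isLt⟩)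

/-- The covariance matrix of a random vector. -/
noncomputable def covMatrix {Ω : Type*} [MeasurableSpace Ω] (μ : Measure Ω)
    (X : Ω → Fin N → ℝ) : Matrix (Fin N) (Fin N) ℝ :=
  Matrix.of fun i j => cov[fun ω => X ω i, fun ω => X ω j; μ]

/-- The matrix `H` of the map `u ↦ u + v` of the relay with taps `h`: ones on the diagonal, `h[ℓ]`
on the `ℓ`-th subdiagonal for `1 ≤ ℓ ≤ L`, zeros elsewhere. -/
def tapMatrix (N : ℕ) (h : Fin L → ℝ) : Matrix (Fin N) (Fin N) ℝ := Matrix.of fun i j =>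
  if i = j then 1
  else if hij : j.val < i.val ∧ i.val - j.val ≤ L then h ⟨i.val - j.val - 1, by omega⟩
  else 0

/-- The effective noise `z̃ = (I - H⁻¹) w + H⁻¹ z`. -/
noncomputable def effNoise (h : Fin L → ℝ) (ω : Outcome N M) : Fin N → ℝ :=
  (1 - (tapMatrix N h)⁻¹) *ᵥ relayNoise ω + (tapMatrix N h)⁻¹ *ᵥ destNoise ω

/-- Relay taps `h` and a source signal `x` that uses the feedback causally, has finite second
moments, and obeys the average power constraints `ρ` at the source and `γ ρ` at the relay. -/
structure IsAdmissible (Kw Kz : Matrix (Fin N) (Fin N) ℝ) (ρ γ : ℝ) (h : Fin L → ℝ)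
    (x : Outcome N M → Fin N → ℝ) : Prop where
  feedback : IsFeedbackInput h x
  memLp : ∀ k, MemLp (fun ω => x ω k) 2 (outcomeLaw M Kw Kz)
  source_power : 1 / ((N : ℝ) + L) * ∑ k, ∫ ω, x ω k ^ 2 ∂(outcomeLaw M Kw Kz) ≤ ρ
  relay_power :
    1 / ((N : ℝ) + L) * ∑ k, ∫ ω, relayOutput h x ω k ^ 2 ∂(outcomeLaw M Kw Kz) ≤ γ * ρ

/-- `(1 / (2 (N + L))) log (det K_{x + z̃} / det K_{z̃})`, in nats. -/
noncomputable def blockRate (Kw Kz : Matrix (Fin N) (Fin N) ℝ) (h : Fin L → ℝ)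
    (x : Outcome N M → Fin N → ℝ) : ℝ :=
  1 / (2 * ((N : ℝ) + L)) *
    Real.log ((covMatrix (outcomeLaw M Kw Kz) (fun ω => x ω + effNoise h ω)).det /
      (covMatrix (outcomeLaw M Kw Kz) (fun ω : Outcome N M => effNoise h ω)).det)

/-- The `(N, L)`-block feedback capacity: the supremum of `blockRate` over all message set sizes
`M ≥ 1`, all relay taps and all source signals that are admissible for them. -/
noncomputable def blockFeedbackCapacity (N L : ℕ) (Kw Kz : Matrix (Fin N) (Fin N) ℝ)
    (ρ γ : ℝ) : EReal :=
  sSup {r : EReal | ∃ (M : ℕ) (h : Fin L → ℝ) (x : Outcome N M → Fin N → ℝ),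
    0 < M ∧ IsAdmissible Kw Kz ρ γ h x ∧ r = ((blockRate Kw Kz h x : ℝ) : EReal)}

/-- `B` is strictly lower triangular. -/
def IsStrictLowerTriangular (B : Matrix (Fin N) (Fin N) ℝ) : Prop :=
  ∀ i j, i ≤ j → B i j = 0

/-- `H` is a lower triangular `L`-banded Toeplitz matrix with ones along the diagonal. -/
structure IsUnitBandedToeplitz (L : ℕ) (H : Matrix (Fin N) (Fin N) ℝ) : Prop where
  diag : ∀ i, H i i = 1
  lower : ∀ i j, i < j → H i j = 0
  banded : ∀ i j, j.val + L < i.val → H i j = 0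
  toeplitz : ∀ i j i' j' : Fin N, i.val + j'.val = i'.val + j.val → H i j = H i' j'

/-- `K_{z̃} = (I - H⁻¹) K_w (I - H⁻¹)ᵀ + H⁻¹ K_z (H⁻¹)ᵀ`. -/
noncomputable def effNoiseCov (Kw Kz H : Matrix (Fin N) (Fin N) ℝ) : Matrix (Fin N) (Fin N) ℝ :=
  (1 - H⁻¹) * Kw * (1 - H⁻¹)ᵀ + H⁻¹ * Kz * (H⁻¹)ᵀ

end RelayChannel

/-! The two suprema agree because the sets of attained rates are equal. Write `z̃` for the effective
noise and `g` for the stacked pair `(w, z)`.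

Converse: since `y = H (x + z̃)` with `H` unit lower triangular, `x[k]` depends only on the message
and the past of `z̃` (`IsFeedbackInput.exists_eq_truncate`). A linear functional of `g` uncorrelated
with that past is independent of it, by joint Gaussianity, hence uncorrelated with `x[k]`, however
nonlinear the encoder. By duality, row `k` of `cov(x, g)` is a combination of the earlier rows of
`cov(z̃, g)`, which gives a strictly lower triangular `B` with `cov(x, g) = B cov(z̃, g)`
(`exists_strictLower_crossCov_eq`). Then `s = x - B z̃` is uncorrelated with both `w` and `z`, and
with `K_s = cov(s)` the rate and the two traces are second-order identities (`blockRate_eq`,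
`crossCov_input`, `crossCov_relayOutput`). The whole of `g` is used, not just `z̃`, because the
relay power involves `cov(x, w)`.

Achievability: the same identities apply to `x = s + B z̃` with `s` a function of the message. Only
the covariance of `s` matters, so a finite centred codebook suffices (`exists_codebook`), and such
an `x` can be computed causally from the feedback (`isFeedbackInput_of_linear`). -/

namespace RelayChannel

/-! ### Bilinear calculus of cross-covariance matrices. -/

section CrossCovariance

variable {Ω ι κ σ : Type*} [MeasurableSpace Ω] {μ : Measure Ω}

/-- The cross-covariance matrix of two random vectors. -/
noncomputable def crossCov (μ : Measure Ω) (X : Ω → ι → ℝ) (Y : Ω → κ → ℝ) : Matrix ι κ ℝ :=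
  Matrix.of fun i j => cov[fun ω => X ω i, fun ω => Y ω j; μ]

theorem crossCov_apply (X : Ω → ι → ℝ) (Y : Ω → κ → ℝ) (i : ι) (j : κ) :
    crossCov μ X Y i j = cov[fun ω => X ω i, fun ω => Y ω j; μ] := rfl

theorem covMatrix_eq_crossCov {N : ℕ} (X : Ω → Fin N → ℝ) : covMatrix μ X = crossCov μ X X := rfl

theorem crossCov_transpose (X : Ω → ι → ℝ) (Y : Ω → κ → ℝ) :
    (crossCov μ X Y)ᵀ = crossCov μ Y X := by
  ext i j
  exact covariance_comm _ _

theorem memLp_mulVec [Fintype ι] (A : Matrix σ ι ℝ) {X : Ω → ι → ℝ}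
    (hX : ∀ i, MemLp (fun ω => X ω i) 2 μ) (k : σ) :
    MemLp (fun ω => (A *ᵥ X ω) k) 2 μ := by
  simp only [mulVec, dotProduct]
  exact memLp_finsetSum _ fun i _ => (hX i).const_mul _

variable [IsFiniteMeasure μ]

theorem crossCov_add_left {X X' : Ω → ι → ℝ} {Y : Ω → κ → ℝ}
    (hX : ∀ i, MemLp (fun ω => X ω i) 2 μ) (hX' : ∀ i, MemLp (fun ω => X' ω i) 2 μ)
    (hY : ∀ i, MemLp (fun ω => Y ω i) 2 μ) :
    crossCov μ (fun ω => X ω + X' ω) Y = crossCov μ X Y + crossCov μ X' Y := by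
  ext i j
  exact covariance_add_left (hX i) (hX' i) (hY j)

theorem crossCov_add_right {X : Ω → ι → ℝ} {Y Y' : Ω → κ → ℝ}
    (hX : ∀ i, MemLp (fun ω => X ω i) 2 μ) (hY : ∀ i, MemLp (fun ω => Y ω i) 2 μ)
    (hY' : ∀ i, MemLp (fun ω => Y' ω i) 2 μ) :
    crossCov μ X (fun ω => Y ω + Y' ω) = crossCov μ X Y + crossCov μ X Y' := by
  ext i j
  exact covariance_add_right (hX i) (hY j) (hY' j)

theorem crossCov_mulVec_left [Fintype ι] (A : Matrix σ ι ℝ) {X : Ω → ι → ℝ} {Y : Ω → κ → ℝ}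
    (hX : ∀ i, MemLp (fun ω => X ω i) 2 μ) (hY : ∀ i, MemLp (fun ω => Y ω i) 2 μ) :
    crossCov μ (fun ω => A *ᵥ X ω) Y = A * crossCov μ X Y := by
  ext k j
  simp only [crossCov_apply, mulVec, dotProduct, mul_apply]
  rw [covariance_fun_sum_left (fun i => (hX i).const_mul _) (hY j)]
  simp only [covariance_const_mul_left]

theorem crossCov_mulVec_right [Fintype κ] (A : Matrix σ κ ℝ) {X : Ω → ι → ℝ} {Y : Ω → κ → ℝ}
    (hX : ∀ i, MemLp (fun ω => X ω i) 2 μ) (hY : ∀ i, MemLp (fun ω => Y ω i) 2 μ) :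
    crossCov μ X (fun ω => A *ᵥ Y ω) = crossCov μ X Y * Aᵀ := by
  rw [← crossCov_transpose, crossCov_mulVec_left A hY hX, transpose_mul, crossCov_transpose]

/-- The quadratic form at `c` is the variance of `c ⬝ᵥ X`; `c` is treated as a one-row matrix so
that the `mulVec` rules apply. -/
theorem crossCov_self_posSemidef [Fintype ι] {X : Ω → ι → ℝ}
    (hX : ∀ i, MemLp (fun ω => X ω i) 2 μ) : (crossCov μ X X).PosSemidef := by
  refine PosSemidef.of_dotProduct_mulVec_nonneg ?_ fun c => ?_
  · ext i j
    exact covariance_comm _ _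
  · have h := crossCov_mulVec_left (Matrix.of fun (_ : Unit) i => c i) hX
      (memLp_mulVec (Matrix.of fun (_ : Unit) i => c i) hX)
    rw [crossCov_mulVec_right _ hX hX] at h
    have h' := congrFun (congrFun h ()) ()
    rw [crossCov_apply, covariance_self (memLp_mulVec _ hX _).aemeasurable] at h'
    have h'' := variance_nonneg (fun ω => ((Matrix.of fun (_ : Unit) i => c i) *ᵥ X ω) ()) μ
    rw [h'] at h''
    simpa [mul_apply, dotProduct, mulVec, Finset.mul_sum, mul_assoc] using h''

end CrossCovariance

/-! ### Triangular matrices and causal row combinations. -/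

section LinearAlgebra

variable {N : ℕ}

theorem IsStrictLowerTriangular.mul_lower {B E : Matrix (Fin N) (Fin N) ℝ}
    (hB : IsStrictLowerTriangular B) (hE : ∀ i j, i < j → E i j = 0) :
    IsStrictLowerTriangular (B * E) := by
  intro i j hij
  rw [mul_apply]
  refine Finset.sum_eq_zero fun l _ => ?_
  rcases le_or_gt i l with h | h
  · rw [hB i l h, zero_mul]
  · rw [hE l j (h.trans_le hij), mul_zero]

theorem IsStrictLowerTriangular.lower_mul {B E : Matrix (Fin N) (Fin N) ℝ}
    (hB : IsStrictLowerTriangular B) (hE : ∀ i j, i < j → E i j = 0) :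
    IsStrictLowerTriangular (E * B) := by
  intro i j hij
  rw [mul_apply]
  refine Finset.sum_eq_zero fun l _ => ?_
  rcases lt_or_ge i l with h | h
  · rw [hE i l h, zero_mul]
  · rw [hB l j (h.trans hij), mul_zero]

theorem isUnit_det_of_unit_lower {H : Matrix (Fin N) (Fin N) ℝ} (hd : ∀ i, H i i = 1)
    (hl : ∀ i j, i < j → H i j = 0) : IsUnit H.det := by
  rw [det_of_isLowerTriangular H fun i j hij => hl i j hij]
  simp [hd]

theorem inv_lower {H : Matrix (Fin N) (Fin N) ℝ} (hd : ∀ i, H i i = 1)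
    (hl : ∀ i j, i < j → H i j = 0) (i j : Fin N) (hij : i < j) : H⁻¹ i j = 0 := by
  have := H.invertibleOfIsUnitDet (isUnit_det_of_unit_lower hd hl)
  have h : H.BlockTriangular OrderDual.toDual := fun i j hij => hl i j hij
  exact blockTriangular_inv_of_blockTriangular h hij

/-- If every vector annihilated by the rows of `D` before the `k`-th is annihilated by the `k`-th
row of `C`, then `C` is a strictly causal combination of the rows of `D`. -/
theorem exists_strictLower_mul_eq {ι : Type*} [Fintype ι] {C D : Matrix (Fin N) ι ℝ}
    (h : ∀ k (c : ι → ℝ), (∀ i < k, (D *ᵥ c) i = 0) → (C *ᵥ c) k = 0) :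
    ∃ B : Matrix (Fin N) (Fin N) ℝ, IsStrictLowerTriangular B ∧ C = B * D := by
  have key (k : Fin N) : ∃ b : Fin N → ℝ,
      (∀ i, k ≤ i → b i = 0) ∧ ∀ j, C k j = ∑ i, b i * D i j := by
    let row (F : Matrix (Fin N) ι ℝ) (i : Fin N) : (ι → ℝ) →ₗ[ℝ] ℝ :=
      LinearMap.proj i ∘ₗ F.mulVecLin
    -- Duality in finite dimension: a functional vanishing on the common kernel of finitely many
    -- others lies in their span. Rows from `k` on are replaced by the zero functional.
    have hmem : row C k ∈
        Submodule.span ℝ (Set.range fun i : Fin N => if i < k then row D i else 0) := by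
      refine mem_span_of_iInf_ker_le_ker fun c hc => h k c fun i hi => ?_
      have := (Submodule.mem_iInf _).1 hc i
      rwa [if_pos hi] at this
    obtain ⟨b, hb⟩ := (Submodule.mem_span_range_iff_exists_fun ℝ).1 hmem
    -- The coefficients at `i ≥ k` multiply the zero functional, so they can be reset to zero.
    refine ⟨fun i => if i < k then b i else 0, fun i hi => if_neg (not_lt.2 hi), fun j => ?_⟩
    classical
    have hrow (F : Matrix (Fin N) ι ℝ) (i : Fin N) : row F i (Pi.single j 1) = F i j := by
      simp [row]
    rw [← hrow C k, ← hb, LinearMap.sum_apply]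
    refine Finset.sum_congr rfl fun i _ => ?_
    by_cases hi : i < k
    · simp [hi, hrow]
    · simp [hi]
  choose b hb hC using key
  exact ⟨Matrix.of b, fun i j hij => hb i j hij, by ext k j; simp [mul_apply, hC]⟩

end LinearAlgebra

variable {N L M : ℕ}

/-! ### The relay filter as a banded Toeplitz matrix. -/

section Taps

theorem tapMatrix_isUnitBandedToeplitz (h : Fin L → ℝ) :
    IsUnitBandedToeplitz L (tapMatrix N h) where
  diag i := by simp [tapMatrix]
  lower i j hij := by
    have h2 : ¬ (j.val < i.val ∧ i.val - j.val ≤ L) := fun hc => absurd hc.1 (not_lt.2 hij.le)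
    simp only [tapMatrix, of_apply, if_neg hij.ne, dif_neg h2]
  banded i j hij := by
    have h1 : ¬ i = j := by rintro rfl; omega
    have h2 : ¬ (j.val < i.val ∧ i.val - j.val ≤ L) := by omega
    simp only [tapMatrix, of_apply, if_neg h1, dif_neg h2]
  toeplitz i j i' j' hij := by
    have h3 : i.val - j.val = i'.val - j'.val := by omega
    simp only [tapMatrix, of_apply, Fin.ext_iff, h3]
    split_ifs <;> first | rfl | omega

theorem IsUnitBandedToeplitz.exists_tapMatrix {H : Matrix (Fin N) (Fin N) ℝ}
    (hH : IsUnitBandedToeplitz L H) : ∃ h : Fin L → ℝ, tapMatrix N h = H := by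
  -- The taps are read off the first column; a delay of `N` or more never shows in an `N × N`
  -- matrix, so its tap may be `0`.
  refine ⟨fun l => if hl : l.val + 1 < N then H ⟨l.val + 1, hl⟩ ⟨0, by omega⟩ else 0, ?_⟩
  ext i j
  have hi := i.isLt
  simp only [tapMatrix, of_apply]
  split_ifs with h1 h2 h3
  · rw [h1, hH.diag]
  · exact hH.toeplitz _ _ _ _ (by simp; omega)
  · omega
  · rcases lt_or_ge i j with h | h
    · rw [hH.lower i j h]
    · have h' : j.val ≤ i.val := h
      have h'' : i.val ≠ j.val := fun e => h1 (Fin.ext e)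
      exact (hH.banded i j (by omega)).symm

theorem firFilter_eq_mulVec (h : Fin L → ℝ) (u : Fin N → ℝ) :
    firFilter h u = (tapMatrix N h - 1) *ᵥ u := by
  ext k
  have hk := k.isLt
  -- A delayed sample is written as a sum over all times `j`, so that exchanging the sums exposes
  -- the matrix row.
  have h1 (l : Fin L) : (if _hl : l.val + 1 ≤ k.val then
      h l * u ⟨k.val - (l.val + 1), lt_of_le_of_lt (Nat.sub_le _ _) k.isLt⟩ else 0) =
      ∑ j : Fin N, if j.val + (l.val + 1) = k.val then h l * u j else 0 := by
    split_ifs with hl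
    · rw [Finset.sum_eq_single ⟨k.val - (l.val + 1), by omega⟩]
      · rw [if_pos (by simp; omega)]
      · intro j _ hj
        refine if_neg fun e => hj (Fin.ext ?_)
        simp; omega
      · simp
    · exact (Finset.sum_eq_zero fun j _ => if_neg (by omega)).symm
  simp only [firFilter, h1, mulVec, dotProduct]
  rw [Finset.sum_comm]
  refine Finset.sum_congr rfl fun j _ => ?_
  simp only [Matrix.sub_apply, tapMatrix, of_apply, one_apply]
  by_cases hkj : k = j
  · subst hkj
    simp
  · by_cases hl : j.val < k.val ∧ k.val - j.val ≤ L
    · rw [if_neg hkj, dif_pos hl, if_neg hkj, sub_zero,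
        Finset.sum_eq_single ⟨k.val - j.val - 1, by omega⟩]
      · rw [if_pos (by simp; omega)]
      · intro l _ hl'
        refine if_neg fun e => hl' (Fin.ext ?_)
        simp; omega
      · simp
    · rw [if_neg hkj, dif_neg hl, if_neg hkj, sub_zero, zero_mul]
      refine Finset.sum_eq_zero fun l _ => if_neg ?_
      have := l.isLt
      have : k.val ≠ j.val := fun e => hkj (Fin.ext e)
      omega

theorem isUnit_det_tapMatrix (h : Fin L → ℝ) : IsUnit (tapMatrix N h).det :=
  isUnit_det_of_unit_lower (tapMatrix_isUnitBandedToeplitz h).diag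
    (tapMatrix_isUnitBandedToeplitz h).lower

/-- The effective noise satisfies `H z̃ = (H - I) w + z`, so observing `y` amounts to observing `x +
z̃`. -/
theorem received_eq_mulVec (h : Fin L → ℝ) (x : Outcome N M → Fin N → ℝ) (ω : Outcome N M) :
    received h x ω = tapMatrix N h *ᵥ (x ω + effNoise h ω) := by
  have hH := mul_nonsing_inv _ (isUnit_det_tapMatrix (N := N) h)
  simp only [received, relayOutput, firFilter_eq_mulVec, effNoise, mulVec_add, mulVec_mulVec,
    hH, one_mulVec, sub_mulVec, mulVec_sub]
  abel

end Taps

/-! ### Moments of the stacked Gaussian noise. -/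

section Noise

/-- The two noise vectors, stacked. -/
def stackedNoise (ω : Outcome N M) : Fin N ⊕ Fin N → ℝ := Sum.elim (relayNoise ω) (destNoise ω)

/-- The matrix that takes the stacked noise vectors to the effective noise. -/
noncomputable def effNoiseMatrix (h : Fin L → ℝ) : Matrix (Fin N) (Fin N ⊕ Fin N) ℝ :=
  fromCols (1 - (tapMatrix N h)⁻¹) (tapMatrix N h)⁻¹

theorem effNoise_eq (h : Fin L → ℝ) (ω : Outcome N M) :
    effNoise h ω = effNoiseMatrix h *ᵥ stackedNoise ω :=
  (fromCols_mulVec_sumElim _ _ _ _).symm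

theorem relayNoise_eq (ω : Outcome N M) :
    relayNoise ω = fromCols (1 : Matrix (Fin N) (Fin N) ℝ) 0 *ᵥ stackedNoise ω := by
  rw [stackedNoise, fromCols_mulVec_sumElim]
  simp

variable (M) in
theorem isProbabilityMeasure_outcomeLaw (hM : 0 < M) (Kw Kz : Matrix (Fin N) (Fin N) ℝ) :
    IsProbabilityMeasure (outcomeLaw M Kw Kz) := by
  have : Nonempty (Fin M) := ⟨⟨0, hM⟩⟩
  have : IsProbabilityMeasure (uniformOn (Set.univ : Set (Fin M))) :=
    isProbabilityMeasure_uniformOn Set.finite_univ Set.univ_nonempty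
  unfold outcomeLaw
  infer_instance

/-- The stacked noise vectors as a linear function of the pair of noise vectors. -/
noncomputable def stackMap (N : ℕ) :
    (EuclideanSpace ℝ (Fin N) × EuclideanSpace ℝ (Fin N)) →L[ℝ] (Fin N ⊕ Fin N → ℝ) :=
  LinearMap.toContinuousLinearMap
    { toFun := fun e => Sum.elim e.1 e.2
      map_add' := fun e e' => by ext (i | i) <;> rfl
      map_smul' := fun c e => by ext (i | i) <;> rfl }

theorem hasGaussianLaw_stackMap (Kw Kz : Matrix (Fin N) (Fin N) ℝ) :
    HasGaussianLaw (stackMap N) ((multivariateGaussian 0 Kw).prod (multivariateGaussian 0 Kz)) :=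
  IsGaussian.hasGaussianLaw_id.map (stackMap N)

theorem memLp_stackMap (Kw Kz : Matrix (Fin N) (Fin N) ℝ) (i : Fin N ⊕ Fin N) :
    MemLp (fun e => stackMap N e i) 2
      ((multivariateGaussian 0 Kw).prod (multivariateGaussian 0 Kz)) :=
  ((hasGaussianLaw_stackMap Kw Kz).eval i).memLp_two

theorem integral_stackMap (Kw Kz : Matrix (Fin N) (Fin N) ℝ) (i : Fin N ⊕ Fin N) :
    ∫ e, stackMap N e i ∂((multivariateGaussian 0 Kw).prod (multivariateGaussian 0 Kz)) = 0 := by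
  have key (K : Matrix (Fin N) (Fin N) ℝ) (j : Fin N) :
      ∫ e, e j ∂(multivariateGaussian 0 K) = 0 := by
    have := (EuclideanSpace.proj j : EuclideanSpace ℝ (Fin N) →L[ℝ] ℝ).integral_comp_id_comm
      (IsGaussian.integrable_id (μ := multivariateGaussian 0 K))
    simpa using this
  rcases i with j | j
  · have := integral_fun_fst (μ := multivariateGaussian 0 Kw) (ν := multivariateGaussian 0 Kz)
      (fun e : EuclideanSpace ℝ (Fin N) => e j)
    exact this.trans (by simp [key])
  · have := integral_fun_snd (μ := multivariateGaussian 0 Kw) (ν := multivariateGaussian 0 Kz)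
      (fun e : EuclideanSpace ℝ (Fin N) => e j)
    exact this.trans (by simp [key])

theorem crossCov_stackMap {Kw Kz : Matrix (Fin N) (Fin N) ℝ} (hKw : Kw.PosSemidef)
    (hKz : Kz.PosSemidef) :
    crossCov ((multivariateGaussian 0 Kw).prod (multivariateGaussian 0 Kz)) (stackMap N)
      (stackMap N) = fromBlocks Kw 0 0 Kz := by
  have hm (K : Matrix (Fin N) (Fin N) ℝ) (j : Fin N) :
      MemLp (fun e : EuclideanSpace ℝ (Fin N) => e j) 2 (multivariateGaussian 0 K) :=
    (IsGaussian.hasGaussianLaw_id.map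
      (EuclideanSpace.proj j : EuclideanSpace ℝ (Fin N) →L[ℝ] ℝ)).memLp_two
  ext (i | i) (j | j)
  · have := covariance_map_fun (μ := (multivariateGaussian 0 Kw).prod (multivariateGaussian 0 Kz))
      (Z := Prod.fst) (X := fun e => e i) (Y := fun e => e j) (by fun_prop) (by fun_prop)
      (by fun_prop)
    rw [Measure.map_fst_prod, measure_univ, one_smul, covariance_eval_multivariateGaussian hKw]
      at this
    exact this.symm
  · exact covariance_fst_snd_prod (hm Kw i) (hm Kz j)
  · rw [← crossCov_transpose]
    exact covariance_fst_snd_prod (hm Kw j) (hm Kz i)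
  · have := covariance_map_fun (μ := (multivariateGaussian 0 Kw).prod (multivariateGaussian 0 Kz))
      (Z := Prod.snd) (X := fun e => e i) (Y := fun e => e j) (by fun_prop) (by fun_prop)
      (by fun_prop)
    rw [Measure.map_snd_prod, measure_univ, one_smul, covariance_eval_multivariateGaussian hKz]
      at this
    exact this.symm

theorem map_snd_outcomeLaw (hM : 0 < M) (Kw Kz : Matrix (Fin N) (Fin N) ℝ) :
    (outcomeLaw M Kw Kz).map Prod.snd =
      (multivariateGaussian 0 Kw).prod (multivariateGaussian 0 Kz) := by
  have : Nonempty (Fin M) := ⟨⟨0, hM⟩⟩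
  have : IsProbabilityMeasure (uniformOn (Set.univ : Set (Fin M))) :=
    isProbabilityMeasure_uniformOn Set.finite_univ Set.univ_nonempty
  rw [outcomeLaw, Measure.map_snd_prod, measure_univ, one_smul]

theorem memLp_stackedNoise (hM : 0 < M) (Kw Kz : Matrix (Fin N) (Fin N) ℝ) (i : Fin N ⊕ Fin N) :
    MemLp (fun ω => stackedNoise ω i) 2 (outcomeLaw M Kw Kz) := by
  have := memLp_stackMap Kw Kz i
  rw [← map_snd_outcomeLaw hM] at this
  exact this.comp_of_map measurable_snd.aemeasurable

theorem integral_stackedNoise (hM : 0 < M) (Kw Kz : Matrix (Fin N) (Fin N) ℝ)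
    (i : Fin N ⊕ Fin N) : ∫ ω, stackedNoise ω i ∂(outcomeLaw M Kw Kz) = 0 := by
  have := integral_stackMap Kw Kz i
  rw [← map_snd_outcomeLaw hM, integral_map measurable_snd.aemeasurable
    (by fun_prop)] at this
  exact this

theorem crossCov_stackedNoise (hM : 0 < M) {Kw Kz : Matrix (Fin N) (Fin N) ℝ}
    (hKw : Kw.PosSemidef) (hKz : Kz.PosSemidef) :
    crossCov (outcomeLaw M Kw Kz) stackedNoise stackedNoise = fromBlocks Kw 0 0 Kz := by
  rw [← crossCov_stackMap hKw hKz, ← map_snd_outcomeLaw hM]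
  ext i j
  rw [crossCov_apply, crossCov_apply,
    covariance_map_fun (by fun_prop) (by fun_prop) measurable_snd.aemeasurable]
  rfl

end Noise

/-! ### Causality and Gaussianity force a strictly causal linear correlation. -/

section Causality

/-- The vector with all coordinates from the `k`-th on set to zero. -/
def truncate (k : Fin N) (v : Fin N → ℝ) : Fin N → ℝ := fun i => if i < k then v i else 0

theorem measurable_truncate (k : Fin N) : Measurable (truncate k) := by
  refine measurable_pi_lambda _ fun i => ?_
  simp only [truncate]
  split_ifs <;> fun_prop

theorem truncate_truncate {j k : Fin N} (hjk : j < k) (v : Fin N → ℝ) :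
    truncate j (truncate k v) = truncate j v := by
  ext i
  by_cases hi : i < j
  · simp [truncate, hi, hi.trans hjk]
  · simp [truncate, hi]

/-- A feedback input is a function of the message and of the past of the effective noise. -/
theorem IsFeedbackInput.exists_eq_truncate {h : Fin L → ℝ} {x : Outcome N M → Fin N → ℝ}
    (hx : IsFeedbackInput h x) (k : Fin N) :
    ∃ F : Fin M → (Fin N → ℝ) → ℝ, (∀ m, Measurable (F m)) ∧
      ∀ ω, x ω k = F ω.1 (truncate k (effNoise h ω)) := by
  obtain ⟨f, hf, hxf⟩ := hx
  induction k using WellFoundedLT.induction with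
  | _ k ih =>
    choose G hG hxG using ih
    -- For `i < k`, `y[i]` is row `i` of `H` applied to `x + z̃`, with earlier inputs supplied by
    -- the induction hypothesis. The default `0` at `j ≥ k` is harmless: there `H i j = 0`.
    refine ⟨fun m v => f k m fun i => ∑ j, tapMatrix N h ⟨i.val, i.isLt.trans k.isLt⟩ j *
      ((if hj : j < k then G j hj m (truncate j v) else 0) + v j), fun m => ?_, fun ω => ?_⟩
    · refine (hf k m).comp (measurable_pi_lambda _ fun i => ?_)
      refine Finset.measurable_sum _ fun j _ =>
        (Measurable.add ?_ (measurable_pi_apply j)).const_mul _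
      split_ifs with hj
      · exact (hG j hj m).comp (measurable_truncate j)
      · exact measurable_const
    · rw [hxf ω k]
      congr 1
      ext i
      rw [received_eq_mulVec, mulVec, dotProduct]
      refine Finset.sum_congr rfl fun j _ => ?_
      by_cases hj : j < k
      · rw [dif_pos hj, truncate_truncate hj, ← hxG j hj ω]
        simp [truncate, hj]
      · have hij : (⟨i.val, i.isLt.trans k.isLt⟩ : Fin N) < j :=
          lt_of_lt_of_le (Fin.lt_def.2 i.isLt) (not_lt.1 hj)
        rw [(tapMatrix_isUnitBandedToeplitz h).lower _ _ hij, zero_mul, zero_mul]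

theorem covariance_dotProduct_right {Ω ι κ : Type*} [MeasurableSpace Ω] {μ : Measure Ω}
    [IsFiniteMeasure μ] [Fintype κ] {X : Ω → ι → ℝ} {Y : Ω → κ → ℝ}
    (hX : ∀ i, MemLp (fun ω => X ω i) 2 μ) (hY : ∀ i, MemLp (fun ω => Y ω i) 2 μ)
    (c : κ → ℝ) (i : ι) :
    cov[fun ω => X ω i, fun ω => Y ω ⬝ᵥ c; μ] = (crossCov μ X Y *ᵥ c) i := by
  simp only [dotProduct, mulVec]
  rw [covariance_fun_sum_right (fun j => (hY j).mul_const _) (hX i)]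
  simp only [covariance_mul_const_right, crossCov_apply]

/-- Gaussian noise that is uncorrelated with the first `k` coordinates of `A *ᵥ stackMap N` is
independent of them. -/
theorem indepFun_truncate {Kw Kz : Matrix (Fin N) (Fin N) ℝ}
    (A : Matrix (Fin N) (Fin N ⊕ Fin N) ℝ) (k : Fin N) (c : Fin N ⊕ Fin N → ℝ)
    (hc : ∀ i < k, ((A * crossCov ((multivariateGaussian 0 Kw).prod (multivariateGaussian 0 Kz))
      (stackMap N) (stackMap N)) *ᵥ c) i = 0) :
    IndepFun (fun e => truncate k (A *ᵥ stackMap N e)) (fun e => stackMap N e ⬝ᵥ c)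
      ((multivariateGaussian 0 Kw).prod (multivariateGaussian 0 Kz)) := by
  let T : (Fin N ⊕ Fin N → ℝ) →ₗ[ℝ] (Fin N → ℝ) × (Unit → ℝ) :=
    { toFun := fun g => (truncate k (A *ᵥ g), fun _ => g ⬝ᵥ c)
      map_add' := fun g g' => by
        ext i
        · by_cases hi : i < k <;> simp [truncate, hi, mulVec_add]
        · simp [add_dotProduct]
      map_smul' := fun a g => by
        ext i
        · by_cases hi : i < k <;> simp [truncate, hi, mulVec_smul]
        · simp [smul_dotProduct] }
  -- The truncated past and the functional are jointly Gaussian, being one linear image of the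
  -- noise, so zero covariance gives independence.
  have hlaw := (hasGaussianLaw_stackMap Kw Kz).map_fun (LinearMap.toContinuousLinearMap T)
  have hind := HasGaussianLaw.indepFun_of_covariance_eval
    (X := fun i e => truncate k (A *ᵥ stackMap N e) i) (Y := fun _ e => stackMap N e ⬝ᵥ c)
    hlaw fun i _ => ?_
  · exact hind.comp measurable_id (measurable_pi_apply ())
  · by_cases hi : i < k
    · simp only [truncate, hi, if_true]
      rw [covariance_dotProduct_right (X := fun e => A *ᵥ stackMap N e)
        (memLp_mulVec A (memLp_stackMap Kw Kz)) (memLp_stackMap Kw Kz),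
        crossCov_mulVec_left A (memLp_stackMap Kw Kz) (memLp_stackMap Kw Kz)]
      exact hc i hi
    · simp only [truncate, hi, if_false]
      exact covariance_const_left 0

/-- For each fixed message, `F m` of the past is independent of the centred functional `g ⬝ᵥ c`, so
their product has mean zero; Fubini then averages over the message. -/
theorem covariance_eq_zero_of_eq_truncate (hM : 0 < M) {Kw Kz : Matrix (Fin N) (Fin N) ℝ}
    (hKw : Kw.PosSemidef) (hKz : Kz.PosSemidef)
    (A : Matrix (Fin N) (Fin N ⊕ Fin N) ℝ) (k : Fin N) (c : Fin N ⊕ Fin N → ℝ)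
    (hc : ∀ i < k, ((A * fromBlocks Kw 0 0 Kz) *ᵥ c) i = 0)
    {F : Fin M → (Fin N → ℝ) → ℝ} (hF : ∀ m, Measurable (F m))
    (hFL : MemLp (fun ω : Outcome N M => F ω.1 (truncate k (A *ᵥ stackedNoise ω))) 2
      (outcomeLaw M Kw Kz)) :
    cov[fun ω : Outcome N M => F ω.1 (truncate k (A *ᵥ stackedNoise ω)),
      fun ω => stackedNoise ω ⬝ᵥ c; outcomeLaw M Kw Kz] = 0 := by
  have := isProbabilityMeasure_outcomeLaw M hM Kw Kz
  have hU : MemLp (fun ω : Outcome N M => stackedNoise ω ⬝ᵥ c) 2 (outcomeLaw M Kw Kz) :=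
    memLp_finsetSum _ fun i _ => (memLp_stackedNoise hM Kw Kz i).mul_const _
  have hU0 : ∫ e, stackMap N e ⬝ᵥ c
      ∂((multivariateGaussian 0 Kw).prod (multivariateGaussian 0 Kz)) = 0 := by
    simp only [dotProduct]
    rw [integral_finsetSum _ fun i _ =>
      ((memLp_stackMap Kw Kz i).integrable one_le_two).mul_const _]
    simp [integral_mul_const, integral_stackMap]
  have hU0' : ∫ ω : Outcome N M, stackedNoise ω ⬝ᵥ c ∂(outcomeLaw M Kw Kz) = 0 := by
    simp only [dotProduct]
    rw [integral_finsetSum _ fun i _ =>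
      ((memLp_stackedNoise hM Kw Kz i).integrable one_le_two).mul_const _]
    simp [integral_mul_const, integral_stackedNoise hM]
  rw [← crossCov_stackMap hKw hKz] at hc
  rw [covariance_eq_sub hFL hU, hU0', mul_zero, sub_zero]
  have hint := hFL.integrable_mul hU
  unfold outcomeLaw at hint ⊢
  rw [integral_prod _ hint]
  refine integral_eq_zero_of_ae (Filter.Eventually.of_forall fun m => ?_)
  have hind := (indepFun_truncate A k c hc).comp (hF m) measurable_id
  have hmul := hind.integral_mul_eq_mul_integral
    (((hF m).comp ((measurable_truncate k).comp (by fun_prop))).aestronglyMeasurable)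
    (by
      simp only [Function.id_comp, dotProduct]
      fun_prop)
  refine hmul.trans ?_
  simp only [Function.id_comp]
  rw [hU0, mul_zero]
  rfl

/-- The heart of the converse: `B` linearizes an arbitrary encoder to second order, leaving `x - B
z̃` uncorrelated with all the noise. -/
theorem exists_strictLower_crossCov_eq (hM : 0 < M) {Kw Kz : Matrix (Fin N) (Fin N) ℝ}
    (hKw : Kw.PosSemidef) (hKz : Kz.PosSemidef) {h : Fin L → ℝ} {x : Outcome N M → Fin N → ℝ}
    (hx : IsFeedbackInput h x) (hxL : ∀ k, MemLp (fun ω => x ω k) 2 (outcomeLaw M Kw Kz)) :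
    ∃ B : Matrix (Fin N) (Fin N) ℝ, IsStrictLowerTriangular B ∧
      crossCov (outcomeLaw M Kw Kz) x stackedNoise =
        B * crossCov (outcomeLaw M Kw Kz) (effNoise h) stackedNoise := by
  have := isProbabilityMeasure_outcomeLaw M hM Kw Kz
  refine exists_strictLower_mul_eq fun k c hc => ?_
  obtain ⟨F, hF, hxF⟩ := hx.exists_eq_truncate k
  have he : (effNoise h : Outcome N M → _) = fun ω => effNoiseMatrix h *ᵥ stackedNoise ω :=
    funext (effNoise_eq h)
  rw [he, crossCov_mulVec_left _ (memLp_stackedNoise hM Kw Kz) (memLp_stackedNoise hM Kw Kz),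
    crossCov_stackedNoise hM hKw hKz] at hc
  rw [← covariance_dotProduct_right hxL (memLp_stackedNoise hM Kw Kz)]
  have hxL := hxL k
  simp only [hxF, effNoise_eq] at hxL ⊢
  exact covariance_eq_zero_of_eq_truncate hM hKw hKz _ k c hc hF hxL

end Causality

/-! ### Power versus covariance trace. -/

section SecondMoments

variable {Ω ι : Type*} [MeasurableSpace Ω] {μ : Measure Ω}

theorem trace_crossCov_of_integral_eq_zero [Fintype ι] {X : Ω → ι → ℝ}
    (hX : ∀ i, MemLp (fun ω => X ω i) 2 μ) (hX0 : ∀ i, ∫ ω, X ω i ∂μ = 0) :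
    (crossCov μ X X).trace = ∑ i, ∫ ω, X ω i ^ 2 ∂μ := by
  refine Finset.sum_congr rfl fun i _ => ?_
  rw [diag_apply, crossCov_apply, covariance_self (hX i).aemeasurable]
  exact variance_of_integral_eq_zero (hX i).aemeasurable (hX0 i)

variable [IsProbabilityMeasure μ]

theorem crossCov_add_self_of_uncorrelated {X Y : Ω → ι → ℝ}
    (hX : ∀ i, MemLp (fun ω => X ω i) 2 μ) (hY : ∀ i, MemLp (fun ω => Y ω i) 2 μ)
    (hXY : crossCov μ X Y = 0) :
    crossCov μ (fun ω => X ω + Y ω) (fun ω => X ω + Y ω) = crossCov μ X X + crossCov μ Y Y := by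
  have hXY' : ∀ i, MemLp (fun ω => (X ω + Y ω) i) 2 μ := fun i => (hX i).add (hY i)
  rw [crossCov_add_left hX hY hXY', crossCov_add_right hX hX hY, crossCov_add_right hY hX hY,
    ← crossCov_transpose X Y, hXY]
  simp

/-- Power counts the mean as well as the variance; dropping the mean can only relax the constraints,
which is what the converse needs. -/
theorem trace_crossCov_le [Fintype ι] {X : Ω → ι → ℝ} (hX : ∀ i, MemLp (fun ω => X ω i) 2 μ) :
    (crossCov μ X X).trace ≤ ∑ i, ∫ ω, X ω i ^ 2 ∂μ := by
  refine Finset.sum_le_sum fun i _ => ?_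
  rw [diag_apply, crossCov_apply, covariance_self (hX i).aemeasurable]
  exact variance_le_expectation_sq (hX i).aestronglyMeasurable

theorem integral_mulVec_eq_zero {σ : Type*} [Fintype ι] (A : Matrix σ ι ℝ) {X : Ω → ι → ℝ}
    (hX : ∀ i, MemLp (fun ω => X ω i) 2 μ) (hX0 : ∀ i, ∫ ω, X ω i ∂μ = 0) (k : σ) :
    ∫ ω, (A *ᵥ X ω) k ∂μ = 0 := by
  simp only [mulVec, dotProduct]
  rw [integral_finsetSum _ fun i _ => ((hX i).integrable one_le_two).const_mul _]
  simp [integral_const_mul, hX0]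

theorem integral_add_eq_zero {X Y : Ω → ι → ℝ} (hX : ∀ i, MemLp (fun ω => X ω i) 2 μ)
    (hY : ∀ i, MemLp (fun ω => Y ω i) 2 μ) (hX0 : ∀ i, ∫ ω, X ω i ∂μ = 0)
    (hY0 : ∀ i, ∫ ω, Y ω i ∂μ = 0) (i : ι) : ∫ ω, (X ω + Y ω) i ∂μ = 0 := by
  simp only [Pi.add_apply]
  rw [integral_add ((hX i).integrable one_le_two) ((hY i).integrable one_le_two), hX0, hY0,
    add_zero]

end SecondMoments

/-! ### Covariances of the effective and relay noises. -/

section NoiseCovariance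

variable {Kw Kz : Matrix (Fin N) (Fin N) ℝ}

theorem effNoise_eq_fun (h : Fin L → ℝ) :
    (effNoise h : Outcome N M → _) = fun ω => effNoiseMatrix h *ᵥ stackedNoise ω :=
  funext (effNoise_eq h)

theorem relayNoise_eq_fun :
    (relayNoise : Outcome N M → _) =
      fun ω => fromCols (1 : Matrix (Fin N) (Fin N) ℝ) 0 *ᵥ stackedNoise ω :=
  funext relayNoise_eq

theorem memLp_effNoise (hM : 0 < M) (h : Fin L → ℝ) (k : Fin N) :
    MemLp (fun ω => effNoise h ω k) 2 (outcomeLaw M Kw Kz) := by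
  simp only [effNoise_eq]
  exact memLp_mulVec _ (memLp_stackedNoise hM Kw Kz) k

theorem memLp_relayNoise (hM : 0 < M) (k : Fin N) :
    MemLp (fun ω => relayNoise ω k) 2 (outcomeLaw M Kw Kz) :=
  memLp_stackedNoise hM Kw Kz (Sum.inl k)

theorem integral_effNoise (hM : 0 < M) (h : Fin L → ℝ) (k : Fin N) :
    ∫ ω, effNoise h ω k ∂(outcomeLaw M Kw Kz) = 0 := by
  have := isProbabilityMeasure_outcomeLaw M hM Kw Kz
  simp only [effNoise_eq]
  exact integral_mulVec_eq_zero _ (memLp_stackedNoise hM Kw Kz) (integral_stackedNoise hM Kw Kz) k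

theorem crossCov_effNoise (hM : 0 < M) (hKw : Kw.PosSemidef) (hKz : Kz.PosSemidef)
    (h : Fin L → ℝ) :
    crossCov (outcomeLaw M Kw Kz) (effNoise h) (effNoise h) =
      effNoiseCov Kw Kz (tapMatrix N h) := by
  have := isProbabilityMeasure_outcomeLaw M hM Kw Kz
  have hg := memLp_stackedNoise hM Kw Kz
  rw [effNoise_eq_fun, crossCov_mulVec_left _ hg (memLp_mulVec _ hg),
    crossCov_mulVec_right _ hg hg, crossCov_stackedNoise hM hKw hKz, ← Matrix.mul_assoc,
    effNoiseMatrix, fromCols_mul_fromBlocks, transpose_fromCols, fromCols_mul_fromRows]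
  simp [effNoiseCov]

theorem crossCov_effNoise_relayNoise (hM : 0 < M) (hKw : Kw.PosSemidef) (hKz : Kz.PosSemidef)
    (h : Fin L → ℝ) :
    crossCov (outcomeLaw M Kw Kz) (effNoise h) relayNoise = (1 - (tapMatrix N h)⁻¹) * Kw := by
  have := isProbabilityMeasure_outcomeLaw M hM Kw Kz
  have hg := memLp_stackedNoise hM Kw Kz
  rw [effNoise_eq_fun, relayNoise_eq_fun, crossCov_mulVec_left _ hg (memLp_mulVec _ hg),
    crossCov_mulVec_right _ hg hg, crossCov_stackedNoise hM hKw hKz, ← Matrix.mul_assoc,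
    effNoiseMatrix, fromCols_mul_fromBlocks, transpose_fromCols, fromCols_mul_fromRows]
  simp

theorem crossCov_relayNoise (hM : 0 < M) (hKw : Kw.PosSemidef) (hKz : Kz.PosSemidef) :
    crossCov (outcomeLaw M Kw Kz) relayNoise relayNoise = Kw := by
  ext i j
  exact congrFun (congrFun (crossCov_stackedNoise hM hKw hKz) (Sum.inl i)) (Sum.inl j)

end NoiseCovariance

/-! ### Second-order identities for `x = s + B z̃`, and its causal realization. -/

section LinearFeedback

variable {Kw Kz : Matrix (Fin N) (Fin N) ℝ} {h : Fin L → ℝ} {x s : Outcome N M → Fin N → ℝ}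
  {B : Matrix (Fin N) (Fin N) ℝ}

theorem crossCov_effNoise_of_uncorrelated (hM : 0 < M) (h : Fin L → ℝ)
    (hsL : ∀ k, MemLp (fun ω => s ω k) 2 (outcomeLaw M Kw Kz))
    (hs : crossCov (outcomeLaw M Kw Kz) s stackedNoise = 0) :
    crossCov (outcomeLaw M Kw Kz) s (effNoise h) = 0 := by
  have := isProbabilityMeasure_outcomeLaw M hM Kw Kz
  rw [effNoise_eq_fun, crossCov_mulVec_right _ hsL (memLp_stackedNoise hM Kw Kz), hs,
    Matrix.zero_mul]

theorem crossCov_relayNoise_of_uncorrelated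
    (hs : crossCov (outcomeLaw M Kw Kz) s stackedNoise = 0) :
    crossCov (outcomeLaw M Kw Kz) s relayNoise = 0 := by
  ext i j
  exact congrFun (congrFun hs i) (Sum.inl j)

/-- Taken with `D = B` for the input `x` and with `D = 1 + B` for `x + z̃`. -/
theorem crossCov_add_mulVec_effNoise (hM : 0 < M) (hKw : Kw.PosSemidef) (hKz : Kz.PosSemidef)
    (hsL : ∀ k, MemLp (fun ω => s ω k) 2 (outcomeLaw M Kw Kz))
    (hs : crossCov (outcomeLaw M Kw Kz) s stackedNoise = 0) (D : Matrix (Fin N) (Fin N) ℝ) :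
    crossCov (outcomeLaw M Kw Kz) (fun ω => s ω + D *ᵥ effNoise h ω)
        (fun ω => s ω + D *ᵥ effNoise h ω) =
      crossCov (outcomeLaw M Kw Kz) s s + D * effNoiseCov Kw Kz (tapMatrix N h) * Dᵀ := by
  have := isProbabilityMeasure_outcomeLaw M hM Kw Kz
  have hz := memLp_effNoise (Kw := Kw) (Kz := Kz) hM h
  rw [crossCov_add_self_of_uncorrelated hsL (memLp_mulVec D hz),
    crossCov_mulVec_left _ hz (memLp_mulVec _ hz), crossCov_mulVec_right _ hz hz,
    crossCov_effNoise hM hKw hKz, Matrix.mul_assoc]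
  rw [crossCov_mulVec_right _ hsL hz, crossCov_effNoise_of_uncorrelated hM h hsL hs,
    Matrix.zero_mul]

theorem covMatrix_add_effNoise (hM : 0 < M) (hKw : Kw.PosSemidef) (hKz : Kz.PosSemidef)
    (hsL : ∀ k, MemLp (fun ω => s ω k) 2 (outcomeLaw M Kw Kz))
    (hs : crossCov (outcomeLaw M Kw Kz) s stackedNoise = 0)
    (hx : ∀ ω, x ω = s ω + B *ᵥ effNoise h ω) :
    covMatrix (outcomeLaw M Kw Kz) (fun ω => x ω + effNoise h ω) =
      crossCov (outcomeLaw M Kw Kz) s s +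
        (1 + B) * effNoiseCov Kw Kz (tapMatrix N h) * (1 + B)ᵀ := by
  rw [← crossCov_add_mulVec_effNoise hM hKw hKz hsL hs (1 + B), covMatrix_eq_crossCov]
  have : (fun ω => x ω + effNoise h ω) = fun ω => s ω + (1 + B) *ᵥ effNoise h ω := by
    ext ω
    rw [hx, add_mulVec, one_mulVec, add_assoc, add_comm (B *ᵥ _)]
  rw [this]

theorem blockRate_eq (hM : 0 < M) (hKw : Kw.PosSemidef) (hKz : Kz.PosSemidef)
    (hsL : ∀ k, MemLp (fun ω => s ω k) 2 (outcomeLaw M Kw Kz))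
    (hs : crossCov (outcomeLaw M Kw Kz) s stackedNoise = 0)
    (hx : ∀ ω, x ω = s ω + B *ᵥ effNoise h ω) :
    blockRate Kw Kz h x = 1 / (2 * ((N : ℝ) + L)) *
      Real.log ((crossCov (outcomeLaw M Kw Kz) s s +
        (1 + B) * effNoiseCov Kw Kz (tapMatrix N h) * (1 + B)ᵀ).det /
        (effNoiseCov Kw Kz (tapMatrix N h)).det) := by
  rw [blockRate, covMatrix_add_effNoise hM hKw hKz hsL hs hx, covMatrix_eq_crossCov,
    crossCov_effNoise hM hKw hKz]

theorem crossCov_input (hM : 0 < M) (hKw : Kw.PosSemidef) (hKz : Kz.PosSemidef)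
    (hsL : ∀ k, MemLp (fun ω => s ω k) 2 (outcomeLaw M Kw Kz))
    (hs : crossCov (outcomeLaw M Kw Kz) s stackedNoise = 0)
    (hx : ∀ ω, x ω = s ω + B *ᵥ effNoise h ω) :
    crossCov (outcomeLaw M Kw Kz) x x =
      crossCov (outcomeLaw M Kw Kz) s s + B * effNoiseCov Kw Kz (tapMatrix N h) * Bᵀ := by
  rw [← crossCov_add_mulVec_effNoise hM hKw hKz hsL hs B, ← funext hx]

theorem memLp_input (hM : 0 < M)
    (hsL : ∀ k, MemLp (fun ω => s ω k) 2 (outcomeLaw M Kw Kz))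
    (hx : ∀ ω, x ω = s ω + B *ᵥ effNoise h ω) (k : Fin N) :
    MemLp (fun ω => x ω k) 2 (outcomeLaw M Kw Kz) := by
  simp only [hx]
  exact (hsL k).add (memLp_mulVec B (memLp_effNoise hM h) k)

theorem relayOutput_eq_fun (h : Fin L → ℝ) (x : Outcome N M → Fin N → ℝ) :
    relayOutput h x = fun ω => (tapMatrix N h - 1) *ᵥ (x ω + relayNoise ω) :=
  funext fun _ => firFilter_eq_mulVec h _

theorem memLp_relayOutput (hM : 0 < M) (h : Fin L → ℝ)
    (hxL : ∀ k, MemLp (fun ω => x ω k) 2 (outcomeLaw M Kw Kz)) (k : Fin N) :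
    MemLp (fun ω => relayOutput h x ω k) 2 (outcomeLaw M Kw Kz) := by
  rw [relayOutput_eq_fun]
  exact memLp_mulVec _ (fun i => (hxL i).add (memLp_relayNoise hM i)) k

/-- The cross terms are `cov(x, w) = B cov(z̃, w)` and its transpose: `s` is uncorrelated with `w`,
but `z̃` contains `(I - H⁻¹) w`. -/
theorem crossCov_relayOutput (hM : 0 < M) (hKw : Kw.PosSemidef) (hKz : Kz.PosSemidef)
    (hsL : ∀ k, MemLp (fun ω => s ω k) 2 (outcomeLaw M Kw Kz))
    (hs : crossCov (outcomeLaw M Kw Kz) s stackedNoise = 0)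
    (hx : ∀ ω, x ω = s ω + B *ᵥ effNoise h ω) :
    crossCov (outcomeLaw M Kw Kz) (relayOutput h x) (relayOutput h x) =
      (tapMatrix N h - 1) *
        (crossCov (outcomeLaw M Kw Kz) s s + B * effNoiseCov Kw Kz (tapMatrix N h) * Bᵀ +
          B * (1 - (tapMatrix N h)⁻¹) * Kw + (B * (1 - (tapMatrix N h)⁻¹) * Kw)ᵀ + Kw) *
        (tapMatrix N h - 1)ᵀ := by
  have := isProbabilityMeasure_outcomeLaw M hM Kw Kz
  have hxL := memLp_input hM hsL hx
  have hwL := memLp_relayNoise (Kw := Kw) (Kz := Kz) hM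
  have hxwL : ∀ k, MemLp (fun ω => (x ω + relayNoise ω) k) 2 (outcomeLaw M Kw Kz) :=
    fun k => (hxL k).add (hwL k)
  have hzL := memLp_effNoise (Kw := Kw) (Kz := Kz) hM h
  have hxw : crossCov (outcomeLaw M Kw Kz) x relayNoise =
      B * (1 - (tapMatrix N h)⁻¹) * Kw := by
    rw [funext hx, crossCov_add_left hsL (memLp_mulVec B hzL) hwL,
      crossCov_relayNoise_of_uncorrelated hs, crossCov_mulVec_left B hzL hwL,
      crossCov_effNoise_relayNoise hM hKw hKz, zero_add, Matrix.mul_assoc]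
  rw [relayOutput_eq_fun, crossCov_mulVec_left _ hxwL (memLp_mulVec _ hxwL),
    crossCov_mulVec_right _ hxwL hxwL, crossCov_add_left hxL hwL hxwL,
    crossCov_add_right hxL hxL hwL, crossCov_add_right hwL hxL hwL,
    ← crossCov_transpose x relayNoise, hxw, crossCov_input hM hKw hKz hsL hs hx,
    crossCov_relayNoise hM hKw hKz, ← Matrix.mul_assoc, ← add_assoc]

/-- A source signal that is a strictly causal linear function of the effective noise, plus a
function of the message, is a feedback input. -/
theorem isFeedbackInput_of_linear (hB : IsStrictLowerTriangular B) (σ : Fin M → Fin N → ℝ)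
    (hx : ∀ ω, x ω = σ ω.1 + B *ᵥ effNoise h ω) : IsFeedbackInput h x := by
  have hH := tapMatrix_isUnitBandedToeplitz (N := N) h
  have hd : ∀ i, (1 + B) i i = 1 := fun i => by
    rw [Matrix.add_apply, hB i i le_rfl, one_apply_eq, add_zero]
  have hl : ∀ i j, i < j → (1 + B) i j = 0 := fun i j hij => by
    rw [Matrix.add_apply, hB i j hij.le, one_apply_ne hij.ne, add_zero]
  have hC : IsStrictLowerTriangular ((1 + B)⁻¹ * B * (tapMatrix N h)⁻¹) :=
    (hB.lower_mul (inv_lower hd hl)).mul_lower (inv_lower hH.diag hH.lower)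
  -- Adding `B x` to both sides of `x = σ + B z̃` gives `(1 + B) x = σ + B (x + z̃) = σ + B H⁻¹ y`,
  -- which trades the unobserved `z̃` for the feedback.
  have hy (ω) : x ω = (1 + B)⁻¹ *ᵥ σ ω.1 +
      ((1 + B)⁻¹ * B * (tapMatrix N h)⁻¹) *ᵥ received h x ω := by
    have h1 : (1 + B) *ᵥ x ω = σ ω.1 + B *ᵥ (x ω + effNoise h ω) := by
      rw [add_mulVec, one_mulVec, mulVec_add, ← add_assoc, add_right_comm, ← hx]
    rw [received_eq_mulVec, mulVec_mulVec, Matrix.mul_assoc,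
      nonsing_inv_mul _ (isUnit_det_tapMatrix h), Matrix.mul_one, ← mulVec_mulVec, ← mulVec_add,
      ← h1, mulVec_mulVec, nonsing_inv_mul _ (isUnit_det_of_unit_lower hd hl), one_mulVec]
  refine ⟨fun k m v => ((1 + B)⁻¹ *ᵥ σ m) k + ∑ j : Fin N, if hj : j < k then
    ((1 + B)⁻¹ * B * (tapMatrix N h)⁻¹) k j * v ⟨j, hj⟩ else 0, fun k m => ?_, fun ω k => ?_⟩
  · refine (Finset.measurable_sum _ fun j _ => ?_).const_add _
    split_ifs <;> fun_prop
  · rw [congrFun (hy ω) k, Pi.add_apply]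
    congr 1
    rw [mulVec, dotProduct]
    refine Finset.sum_congr rfl fun j _ => ?_
    split_ifs with hj
    · rfl
    · rw [hC k j (not_lt.1 hj), zero_mul]

end LinearFeedback

/-! ### A finite codebook with prescribed covariance. -/

section Codebook

open scoped MatrixOrder

theorem integral_message (hM : 0 < M) (Kw Kz : Matrix (Fin N) (Fin N) ℝ) (f : Fin M → ℝ) :
    ∫ ω, f ω.1 ∂(outcomeLaw M Kw Kz) = (M : ℝ)⁻¹ * ∑ m, f m := by
  have : Nonempty (Fin M) := ⟨⟨0, hM⟩⟩
  rw [outcomeLaw, integral_fun_fst, probReal_univ, one_smul, uniformOn, ProbabilityTheory.cond,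
    Measure.restrict_univ, integral_smul_measure, integral_count]
  simp

/-- A positive semidefinite matrix is the covariance matrix of the uniform law on a centred set of
`2 N` vectors. -/
theorem exists_codebook {Ks : Matrix (Fin N) (Fin N) ℝ} (hKs : Ks.PosSemidef) :
    ∃ σ : Fin (N * 2) → Fin N → ℝ, (∀ i, ∑ m, σ m i = 0) ∧
      ∀ i j, ((N * 2 : ℕ) : ℝ)⁻¹ * ∑ m, σ m i * σ m j = Ks i j := by
  obtain ⟨A, hA⟩ := CStarAlgebra.nonneg_iff_eq_star_mul_self.1 hKs.nonneg
  rw [star_eq_conjTranspose] at hA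
  -- With `Ks = Aᵀ A`, the codewords are `±√N` times the rows of `A`: the signs centre the code, and
  -- `√N` offsets averaging over `2 N` words.
  refine ⟨fun m i => (if (finProdFinEquiv.symm m).2 = 0 then 1 else -1) *
    (√N * A (finProdFinEquiv.symm m).1 i), fun i => ?_, fun i j => ?_⟩
  · rw [← finProdFinEquiv.sum_comp, Fintype.sum_prod_type]
    simp
  · rw [← finProdFinEquiv.sum_comp, Fintype.sum_prod_type, hA]
    rcases Nat.eq_zero_or_pos N with rfl | hN
    · exact i.elim0
    have hN' : (N : ℝ) ≠ 0 := by positivity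
    have hsq : √(N : ℝ) * √N = N := Real.mul_self_sqrt (Nat.cast_nonneg N)
    simp only [Equiv.symm_apply_apply, Fin.sum_univ_two, mul_apply, conjTranspose_apply,
      star_trivial, Finset.mul_sum]
    refine Finset.sum_congr rfl fun n _ => ?_
    push_cast
    simp
    field_simp
    linear_combination (2 * A n i * A n j) * hsq

theorem memLp_message (hM : 0 < M) (Kw Kz : Matrix (Fin N) (Fin N) ℝ) (σ : Fin M → Fin N → ℝ)
    (k : Fin N) : MemLp (fun ω => σ ω.1 k) 2 (outcomeLaw M Kw Kz) := by
  have : Nonempty (Fin M) := ⟨⟨0, hM⟩⟩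
  have hσ : MemLp (fun m => σ m k) 2 (uniformOn (Set.univ : Set (Fin M))) := MemLp.of_discrete
  exact hσ.comp_fst _

theorem crossCov_message_stackedNoise (hM : 0 < M) (Kw Kz : Matrix (Fin N) (Fin N) ℝ)
    (σ : Fin M → Fin N → ℝ) :
    crossCov (outcomeLaw M Kw Kz) (fun ω => σ ω.1) stackedNoise = 0 := by
  have : Nonempty (Fin M) := ⟨⟨0, hM⟩⟩
  ext i j
  have hσ : MemLp (fun m => σ m i) 2 (uniformOn (Set.univ : Set (Fin M))) := MemLp.of_discrete
  exact covariance_fst_snd_prod hσ (memLp_stackMap Kw Kz j)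

theorem crossCov_message (hM : 0 < M) (Kw Kz : Matrix (Fin N) (Fin N) ℝ)
    {σ : Fin M → Fin N → ℝ} {Ks : Matrix (Fin N) (Fin N) ℝ} (hσ0 : ∀ i, ∑ m, σ m i = 0)
    (hσ : ∀ i j, (M : ℝ)⁻¹ * ∑ m, σ m i * σ m j = Ks i j) :
    crossCov (outcomeLaw M Kw Kz) (fun ω => σ ω.1) (fun ω => σ ω.1) = Ks := by
  have := isProbabilityMeasure_outcomeLaw M hM Kw Kz
  ext i j
  rw [crossCov_apply, covariance_eq_sub (memLp_message hM Kw Kz σ i) (memLp_message hM Kw Kz σ j),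
    integral_message hM Kw Kz fun m => σ m i, hσ0, mul_zero, zero_mul, sub_zero, ← hσ]
  exact integral_message hM Kw Kz fun m => σ m i * σ m j

end Codebook

end RelayChannel

/-! ### Equality of the two sets of rates. -/

theorem mainTheorem5 (N L : ℕ) (Kw Kz : Matrix (Fin N) (Fin N) ℝ) (ρ γ : ℝ)
    (hN : 1 ≤ N) (hKw : Kw.PosSemidef) (hKz : Kz.PosDef) (hρ : 0 < ρ) (hγ : 0 ≤ γ) :
    RelayChannel.blockFeedbackCapacity N L Kw Kz ρ γ =
      sSup {r : EReal | ∃ Ks B H : Matrix (Fin N) (Fin N) ℝ,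
        Ks.PosSemidef ∧
        RelayChannel.IsStrictLowerTriangular B ∧
        RelayChannel.IsUnitBandedToeplitz L H ∧
        (Ks + B * RelayChannel.effNoiseCov Kw Kz H * Bᵀ).trace ≤ ((N : ℝ) + L) * ρ ∧
        ((H - 1) *
            (Ks + B * RelayChannel.effNoiseCov Kw Kz H * Bᵀ + B * (1 - H⁻¹) * Kw
              + (B * (1 - H⁻¹) * Kw)ᵀ + Kw) *
            (H - 1)ᵀ).trace ≤ γ * ((N : ℝ) + L) * ρ ∧
        r = ((1 / (2 * ((N : ℝ) + L)) *
          Real.log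
            ((Ks + (1 + B) * RelayChannel.effNoiseCov Kw Kz H * (1 + B)ᵀ).det /
              (RelayChannel.effNoiseCov Kw Kz H).det) : ℝ) : EReal)} := by
  have hNL : 0 < (N : ℝ) + L := by positivity
  have hpow (a b : ℝ) : 1 / ((N : ℝ) + L) * a ≤ b ↔ a ≤ ((N : ℝ) + L) * b := by
    rw [one_div, inv_mul_le_iff₀ hNL]
  have hKz' := hKz.posSemidef
  rw [RelayChannel.blockFeedbackCapacity]
  congr 1
  ext r
  constructor
  · rintro ⟨M, h, x, hM, hx, rfl⟩
    have := RelayChannel.isProbabilityMeasure_outcomeLaw M hM Kw Kz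
    obtain ⟨B, hB, hxB⟩ :=
      RelayChannel.exists_strictLower_crossCov_eq hM hKw hKz' hx.feedback hx.memLp
    have hg := RelayChannel.memLp_stackedNoise hM Kw Kz
    have hz := RelayChannel.memLp_effNoise (Kw := Kw) (Kz := Kz) hM h
    -- The part of the input uncorrelated with the noise; its covariance is the witness for `Ks`. It
    -- need not be a function of the message.
    let s : RelayChannel.Outcome N M → Fin N → ℝ := fun ω =>
      x ω + (-B) *ᵥ RelayChannel.effNoise h ω
    have hxs : ∀ ω, x ω = s ω + B *ᵥ RelayChannel.effNoise h ω := fun ω => by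
      simp [s, neg_mulVec]
    have hsL : ∀ k, MemLp (fun ω => s ω k) 2 (RelayChannel.outcomeLaw M Kw Kz) := fun k =>
      (hx.memLp k).add (RelayChannel.memLp_mulVec _ hz k)
    have hs : RelayChannel.crossCov (RelayChannel.outcomeLaw M Kw Kz) s
        RelayChannel.stackedNoise = 0 := by
      rw [RelayChannel.crossCov_add_left hx.memLp (RelayChannel.memLp_mulVec _ hz) hg,
        RelayChannel.crossCov_mulVec_left _ hz hg, hxB, Matrix.neg_mul, add_neg_cancel]
    refine ⟨_, B, RelayChannel.tapMatrix N h, RelayChannel.crossCov_self_posSemidef hsL, hB,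
      RelayChannel.tapMatrix_isUnitBandedToeplitz h, ?_, ?_,
      congrArg _ (RelayChannel.blockRate_eq hM hKw hKz' hsL hs hxs)⟩
    · rw [← RelayChannel.crossCov_input hM hKw hKz' hsL hs hxs]
      exact (RelayChannel.trace_crossCov_le hx.memLp).trans ((hpow _ _).1 hx.source_power)
    · rw [← RelayChannel.crossCov_relayOutput hM hKw hKz' hsL hs hxs, mul_comm γ, mul_assoc]
      exact (RelayChannel.trace_crossCov_le
        (RelayChannel.memLp_relayOutput hM h hx.memLp)).trans ((hpow _ _).1 hx.relay_power)
  · rintro ⟨Ks, B, H, hKs, hB, hH, hsrc, hrel, rfl⟩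
    obtain ⟨h, rfl⟩ := hH.exists_tapMatrix
    obtain ⟨σ, hσ0, hσ⟩ := RelayChannel.exists_codebook hKs
    have hM : 0 < N * 2 := by omega
    have := RelayChannel.isProbabilityMeasure_outcomeLaw (N * 2) hM Kw Kz
    let s : RelayChannel.Outcome N (N * 2) → Fin N → ℝ := fun ω => σ ω.1
    let x : RelayChannel.Outcome N (N * 2) → Fin N → ℝ := fun ω =>
      s ω + B *ᵥ RelayChannel.effNoise h ω
    have hxs : ∀ ω, x ω = s ω + B *ᵥ RelayChannel.effNoise h ω := fun ω => rfl
    have hsL := RelayChannel.memLp_message hM Kw Kz σ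
    have hs := RelayChannel.crossCov_message_stackedNoise hM Kw Kz σ
    have hss := RelayChannel.crossCov_message hM Kw Kz hσ0 hσ
    have hxL := RelayChannel.memLp_input hM hsL hxs
    -- Zero means make the powers equal to the covariance traces, so both trace bounds transfer
    -- exactly.
    have hx0 (k) : ∫ ω, x ω k ∂(RelayChannel.outcomeLaw (N * 2) Kw Kz) = 0 := by
      refine RelayChannel.integral_add_eq_zero hsL
        (RelayChannel.memLp_mulVec B (RelayChannel.memLp_effNoise hM h)) (fun k => ?_)
        (RelayChannel.integral_mulVec_eq_zero B (RelayChannel.memLp_effNoise hM h)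
          (RelayChannel.integral_effNoise hM h)) k
      rw [RelayChannel.integral_message hM Kw Kz fun m => σ m k, hσ0, mul_zero]
    have hv0 (k) : ∫ ω, RelayChannel.relayOutput h x ω k
        ∂(RelayChannel.outcomeLaw (N * 2) Kw Kz) = 0 := by
      rw [RelayChannel.relayOutput_eq_fun]
      exact RelayChannel.integral_mulVec_eq_zero _
        (fun i => (hxL i).add (RelayChannel.memLp_relayNoise hM i))
        (RelayChannel.integral_add_eq_zero hxL (RelayChannel.memLp_relayNoise hM) hx0
          fun i => RelayChannel.integral_stackedNoise hM Kw Kz (Sum.inl i)) k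
    refine ⟨N * 2, h, x, hM, ⟨RelayChannel.isFeedbackInput_of_linear hB σ hxs, hxL, ?_, ?_⟩, ?_⟩
    · rw [hpow, ← RelayChannel.trace_crossCov_of_integral_eq_zero hxL hx0,
        RelayChannel.crossCov_input hM hKw hKz' hsL hs hxs, hss]
      exact hsrc
    · rw [hpow, ← RelayChannel.trace_crossCov_of_integral_eq_zero
        (RelayChannel.memLp_relayOutput hM h hxL) hv0,
        RelayChannel.crossCov_relayOutput hM hKw hKz' hsL hs hxs, hss, ← mul_assoc,
        mul_comm _ γ]
      exact hrel
    · rw [RelayChannel.blockRate_eq hM hKw hKz' hsL hs hxs, hss]
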